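/- Let $\mathcal V=(\mathcal V,\otimes,\mathrm k)$ be a commutative unital quantale, that is, a complete lattice with a commutative monoid structure whose multiplication preserves arbitrary suprema in each variable, and let $[x,-]$ denote the right adjoint of $-\otimes x$. A $\mathcal V$-category $X$ is a set $X$ with a map $X(-,-)\colon X\times X\to\mathcal V$ such that $\mathrm k\le X(x,x)$ and $X(y,z)\otimes X(x,y)\le X(x,z)$. A $\mathcal V$-functor $f\colon X\to Y$ is a map with $X(x,x')\le Y(fx,fx')$, and $f\le g$ means $\mathrm k\le Y(fx,gx)$ for all $x$. A $\mathcal V$-distributor $\varphi\colon X\nrightarrow Y$ is a $\mathcal V$-functor $X^{\mathrm{op}}\otimes Y\to\mathcal V$; composition is $(\psi\cdot\varphi)(x,z)=\bigvee_{y}\psi(y,z)\otimes\varphi(x,y)$, the identity on $X$ is $X(-,-)$, and the 2-cells are given by the pointwise order. A $\mathcal V$-normed set is a set $A$ with a map $|{-}|\colon A\to\mathcal V$. A $\mathcal V$-normed category is a category with normed hom-sets such that $\mathrm k\le|1_a|$ and $|g|\otimes|f|\le|g\cdot f|$; a $\mathcal V$-normed functor $F$ satisfies $|f|\le|Ff|$,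 and a $\mathcal V$-normed natural transformation $\alpha$ satisfies $\mathrm k\le|\alpha_a|$ for all objects $a$. The $\mathcal V$-normed sets with arbitrary maps, normed by $|\varphi|=\bigwedge_{a}[|a|,|\varphi a|]$, form a $\mathcal V$-normed category $\mathcal S$. A $\mathcal V$-normed distributor $\Phi\colon\mathbb A\nrightarrow\mathbb B$ between small $\mathcal V$-normed categories is a $\mathcal V$-normed functor $\mathbb A^{\mathrm{op}}\otimes\mathbb B\to\mathcal S$, where $\mathbb A^{\mathrm{op}}\otimes\mathbb B$ is the product category normed by $|(f,g)|=|f|\otimes|g|$. Composition is the coend $(\Psi\cdot\Phi)(a,c)=\int^{b}\Psi(b,c)\times\Phi(a,b)$ of sets, in which the norm of an element is the supremum of $|v|\otimes|u|$ over all pairs $(v,u)$ representing it; the identity on $\mathbb A$ is $\mathbb A(-,-)$, and the 2-cells are the $\mathcal V$-normed natural transformations. A small $\mathcal V$-category (respectively, small $\mathcal V$-normed category) $\mathcal A$ is Lawvere complete if every $\mathcal V$-distributor (respectively, $\mathcal V$-normed distributor) $\Phi\colon\mathcal X\nrightarrow\mathcal A$ with $\mathcal X$ small that is a left adjoint in the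 bicategory so described is representable: there is a $\mathcal V$-functor (respectively, $\mathcal V$-normed functor) $F\colon\mathcal X\to\mathcal A$ with $\Phi\cong F_*$, where $F_*(x,a)=\mathcal A(Fx,a)$. For a $\mathcal V$-category $X$ let $\mathrm i(X)$ be the $\mathcal V$-normed category with the same objects as $X$ and with exactly one arrow $x\to y$ for each pair $(x,y)$ of objects, of norm $X(x,y)$. **Corollary.** Let $X$ be a small $\mathcal V$-category, and assume that $X$ is non-empty or that $\mathcal V$ has more than one element. Then $X$ is Lawvere complete if and only if the $\mathcal V$-normed category $\mathrm i(X)$ is Lawvere complete. -/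

import Mathlib

open CategoryTheory Bicategory Quantale

universe w w' u v

/-! Throughout, `V` is a commutative unital quantale: the tensor product is `*`, its neutral
element `k` is `1`, and the internal hom `[x, y]` is `x ⇨ₗ y` (so `z ≤ x ⇨ₗ y ↔ z * x ≤ y`). -/

section Quantale

variable (V : Type v) [CommMonoid V] [CompleteLattice V] [IsQuantale V]

/-! ### `V`-categories -/

/-- A `V`-category. It is small when its carrier lives in the fixed universe. -/
structure VCat where
  carrier : Type w
  hom : carrier → carrier → V
  one_le_hom : ∀ x, 1 ≤ hom x x
  hom_mul_hom_le : ∀ x y z, hom y z * hom x y ≤ hom x z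

variable {V}

/-- A `V`-functor. -/
structure VFunctor (X : VCat.{w} V) (Y : VCat.{w'} V) where
  obj : X.carrier → Y.carrier
  hom_le : ∀ x x', X.hom x x' ≤ Y.hom (obj x) (obj x')

/-- `f ≤ g` holds iff there is a (necessarily unique) `V`-natural transformation `f → g`. -/
instance (X : VCat.{w} V) (Y : VCat.{w'} V) : Preorder (VFunctor X Y) where
  le f g := ∀ x, 1 ≤ Y.hom (f.obj x) (g.obj x)
  le_refl f x := Y.one_le_hom _
  le_trans f g h hfg hgh x := by
    have h2 := mul_le_mul' (hgh x) (hfg x)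
    rw [one_mul] at h2
    exact h2.trans (Y.hom_mul_hom_le _ _ _)

namespace VCat

/-- The opposite `V`-category. -/
abbrev op (X : VCat.{w} V) : VCat.{w} V where
  carrier := X.carrier
  hom x y := X.hom y x
  one_le_hom x := X.one_le_hom x
  hom_mul_hom_le x y z := by
    rw [mul_comm]
    exact X.hom_mul_hom_le z y x

/-- The tensor product of `V`-categories. -/
abbrev tensor (X : VCat.{w} V) (Y : VCat.{w'} V) : VCat.{max w w'} V where
  carrier := X.carrier × Y.carrier
  hom p q := X.hom p.1 q.1 * Y.hom p.2 q.2
  one_le_hom p := one_le_mul (X.one_le_hom _) (Y.one_le_hom _)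
  hom_mul_hom_le p q r := by
    rw [mul_mul_mul_comm]
    exact mul_le_mul' (X.hom_mul_hom_le _ _ _) (Y.hom_mul_hom_le _ _ _)

variable (V) in
/-- `V` as a `V`-category, through its internal hom. -/
abbrev base : VCat.{v} V where
  carrier := V
  hom x y := x ⇨ₗ y
  one_le_hom x := by
    rw [leftMulResiduation_le_iff_mul_le, one_mul]
  hom_mul_hom_le x y z := by
    rw [leftMulResiduation_le_iff_mul_le, mul_assoc]
    exact (mul_le_mul_right (leftMulResiduation_le_iff_mul_le.1 le_rfl) _).trans
      (leftMulResiduation_le_iff_mul_le.1 le_rfl)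

end VCat

/-! ### `V`-distributors -/

/-- A `V`-distributor from `X` to `Y` is a `V`-functor `Xᵒᵖ ⊗ Y → V`. -/
abbrev VDist (X Y : VCat.{u} V) := VFunctor (X.op.tensor Y) (VCat.base V)

namespace VDist

variable {X Y Z W : VCat.{u} V}

/-- The value `φ(x, y)`. -/
abbrev val (φ : VDist X Y) (x : X.carrier) (y : Y.carrier) : V := φ.obj (x, y)

theorem act_le (φ : VDist X Y) (x' x : X.carrier) (y y' : Y.carrier) :
    X.hom x' x * Y.hom y y' * φ.val x y ≤ φ.val x' y' :=
  leftMulResiduation_le_iff_mul_le.1 (φ.hom_le (x, y) (x', y'))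

/-- Build a `V`-distributor from its values. -/
abbrev ofVal (f : X.carrier → Y.carrier → V)
    (hf : ∀ x' x y y', X.hom x' x * Y.hom y y' * f x y ≤ f x' y') : VDist X Y where
  obj p := f p.1 p.2
  hom_le p q := leftMulResiduation_le_iff_mul_le.2 (hf q.1 p.1 p.2 q.2)

theorem le_iff {φ ψ : VDist X Y} : φ ≤ ψ ↔ ∀ x y, φ.val x y ≤ ψ.val x y := by
  constructor
  · intro h x y
    have h2 := leftMulResiduation_le_iff_mul_le.1 (h (x, y))
    rwa [one_mul] at h2
  · intro h p
    refine leftMulResiduation_le_iff_mul_le.2 ?_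
    rw [one_mul]
    exact h p.1 p.2

/-- The identity distributor `X(-, -)`. -/
abbrev id (X : VCat.{u} V) : VDist X X :=
  ofVal X.hom fun x' x y y' => by
    rw [mul_comm (X.hom x' x), mul_assoc, mul_comm (X.hom x' x), ← mul_assoc]
    exact (mul_le_mul_left (X.hom_mul_hom_le _ _ _) _).trans (X.hom_mul_hom_le _ _ _)

/-- The composite `ψ · φ`, `(ψ · φ)(x, z) = ⋁ y, ψ(y, z) ⊗ φ(x, y)`. -/
abbrev comp (φ : VDist X Y) (ψ : VDist Y Z) : VDist X Z :=
  ofVal (fun x z => ⨆ y, ψ.val y z * φ.val x y) fun x' x z z' => by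
    rw [mul_iSup_distrib]
    refine iSup_mono fun y => ?_
    have h1 : X.hom x' x * φ.val x y ≤ φ.val x' y := by
      refine le_trans ?_ (φ.act_le x' x y y)
      exact mul_le_mul_left (le_mul_of_one_le_right' (Y.one_le_hom y)) _
    have h2 : Z.hom z z' * ψ.val y z ≤ ψ.val y z' := by
      refine le_trans ?_ (ψ.act_le y y z z')
      exact mul_le_mul_left (le_mul_of_one_le_left' (Y.one_le_hom y)) _
    calc X.hom x' x * Z.hom z z' * (ψ.val y z * φ.val x y)
        = (Z.hom z z' * ψ.val y z) * (X.hom x' x * φ.val x y) := by ac_rfl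
      _ ≤ _ := mul_le_mul' h2 h1

theorem comp_mono {φ φ' : VDist X Y} {ψ ψ' : VDist Y Z} (h : φ ≤ φ') (h' : ψ ≤ ψ') :
    comp φ ψ ≤ comp φ' ψ' :=
  le_iff.2 fun x z => iSup_mono fun y => mul_le_mul' (le_iff.1 h' y z) (le_iff.1 h x y)

theorem comp_assoc_le (φ : VDist X Y) (ψ : VDist Y Z) (χ : VDist Z W) :
    comp (comp φ ψ) χ ≤ comp φ (comp ψ χ) :=
  le_iff.2 fun x w => iSup_le fun z => by
    change χ.val z w * (⨆ y, ψ.val y z * φ.val x y) ≤ _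
    rw [mul_iSup_distrib]
    refine iSup_le fun y => le_iSup_of_le y ?_
    rw [← mul_assoc]
    exact mul_le_mul_left (le_iSup (fun z => χ.val z w * ψ.val y z) z) _

theorem le_comp_assoc (φ : VDist X Y) (ψ : VDist Y Z) (χ : VDist Z W) :
    comp φ (comp ψ χ) ≤ comp (comp φ ψ) χ :=
  le_iff.2 fun x w => iSup_le fun y => by
    change (⨆ z, χ.val z w * ψ.val y z) * φ.val x y ≤ _
    rw [iSup_mul_distrib]
    refine iSup_le fun z => le_iSup_of_le z ?_
    rw [mul_assoc]
    exact mul_le_mul_right (le_iSup (fun y => ψ.val y z * φ.val x y) y) _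

theorem id_comp_le (φ : VDist X Y) : comp (id X) φ ≤ φ :=
  le_iff.2 fun x y => iSup_le fun x' => by
    refine le_trans ?_ (φ.act_le x x' y y)
    rw [mul_comm (φ.val x' y)]
    exact mul_le_mul_left (le_mul_of_one_le_right' (Y.one_le_hom y)) _

theorem le_id_comp (φ : VDist X Y) : φ ≤ comp (id X) φ :=
  le_iff.2 fun x _ => le_iSup_of_le x (le_mul_of_one_le_right' (X.one_le_hom x))

theorem comp_id_le (φ : VDist X Y) : comp φ (id Y) ≤ φ :=
  le_iff.2 fun x y => iSup_le fun y' => by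
    refine le_trans ?_ (φ.act_le x x y' y)
    exact mul_le_mul_left (le_mul_of_one_le_left' (X.one_le_hom x)) _

theorem le_comp_id (φ : VDist X Y) : φ ≤ comp φ (id Y) :=
  le_iff.2 fun _ y => le_iSup_of_le y (le_mul_of_one_le_left' (Y.one_le_hom y))

end VDist

/-- The bicategory of small `V`-categories, `V`-distributors and `V`-natural transformations. -/
instance : Bicategory (VCat.{u} V) where
  Hom X Y := VDist X Y
  id X := VDist.id X
  comp φ ψ := VDist.comp φ ψ
  homCategory X Y := Preorder.smallCategory (VDist X Y)
  whiskerLeft φ _ _ η := homOfLE (VDist.comp_mono (le_refl φ) (leOfHom η))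
  whiskerRight η ψ := homOfLE (VDist.comp_mono (leOfHom η) (le_refl ψ))
  associator φ ψ χ := ⟨homOfLE (VDist.comp_assoc_le φ ψ χ), homOfLE (VDist.le_comp_assoc φ ψ χ),
    Subsingleton.elim _ _, Subsingleton.elim _ _⟩
  leftUnitor φ := ⟨homOfLE (VDist.id_comp_le φ), homOfLE (VDist.le_id_comp φ),
    Subsingleton.elim _ _, Subsingleton.elim _ _⟩
  rightUnitor φ := ⟨homOfLE (VDist.comp_id_le φ), homOfLE (VDist.le_comp_id φ),
    Subsingleton.elim _ _, Subsingleton.elim _ _⟩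
  whiskerLeft_id _ _ := Subsingleton.elim _ _
  whiskerLeft_comp _ _ _ _ _ _ := Subsingleton.elim _ _
  id_whiskerLeft _ := Subsingleton.elim _ _
  comp_whiskerLeft _ _ _ _ _ := Subsingleton.elim _ _
  id_whiskerRight _ _ := Subsingleton.elim _ _
  comp_whiskerRight _ _ _ := Subsingleton.elim _ _
  whiskerRight_id _ := Subsingleton.elim _ _
  whiskerRight_comp _ _ _ := Subsingleton.elim _ _
  whisker_assoc _ _ _ _ _ := Subsingleton.elim _ _
  whisker_exchange _ _ := Subsingleton.elim _ _
  pentagon _ _ _ _ := Subsingleton.elim _ _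
  triangle _ _ := Subsingleton.elim _ _

/-- The distributor `F_*` of a `V`-functor `F : X → Y`, `F_*(x, y) = Y(F x, y)`. -/
def VFunctor.lowerStar {X Y : VCat.{u} V} (F : VFunctor X Y) : VDist X Y :=
  VDist.ofVal (fun x y => Y.hom (F.obj x) y) fun x' x y y' => by
    refine le_trans ?_ ((VDist.id Y).act_le (F.obj x') (F.obj x) y y')
    exact mul_le_mul_left (mul_le_mul_left (F.hom_le _ _) _) _

/-- A small `V`-category is Lawvere complete when every `V`-distributor into it that is a left
adjoint in the bicategory of distributors is representable. -/
def VCat.LawvereComplete (A : VCat.{u} V) : Prop :=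
  ∀ (X : VCat.{u} V) (φ : X ⟶ A), IsLeftAdjoint φ →
    ∃ F : VFunctor X A, Nonempty (φ ≅ (F.lowerStar : X ⟶ A))

/-! ### `V`-normed sets and `V`-normed categories -/

variable (V) in
/-- A `V`-normed set. -/
structure NSet where
  carrier : Type u
  nrm : carrier → V

variable (V) in
/-- A `V`-normed category: a category with normed hom-sets, such that `k ≤ |1_a|` and
`|g| ⊗ |f| ≤ |g · f|`. Note that `f ≫ g` denotes `g · f`. -/
structure NCat where
  carrier : Type w
  [cat : Category.{u} carrier]
  nrm : ∀ {a b : carrier}, (a ⟶ b) → V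
  one_le_nrm_id : ∀ a : carrier, 1 ≤ nrm (𝟙 a)
  nrm_mul_nrm_le : ∀ {a b c : carrier} (f : a ⟶ b) (g : b ⟶ c), nrm g * nrm f ≤ nrm (f ≫ g)

attribute [instance] NCat.cat

/-- A `V`-normed functor: a functor with `|f| ≤ |F f|`. -/
structure NFunctor (A : NCat.{w, u} V) (B : NCat.{w', u} V) extends A.carrier ⥤ B.carrier where
  nrm_le : ∀ {a a' : A.carrier} (f : a ⟶ a'), A.nrm f ≤ B.nrm (map f)

/-- A `V`-normed natural transformation: a natural transformation `α` with `k ≤ |α_a|`. -/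
@[ext]
structure NNatTrans {A : NCat.{w, u} V} {B : NCat.{w', u} V} (F G : NFunctor A B) where
  toNatTrans : F.toFunctor ⟶ G.toFunctor
  one_le_nrm : ∀ a, 1 ≤ B.nrm (toNatTrans.app a)

instance (A : NCat.{w, u} V) (B : NCat.{w', u} V) : Category (NFunctor A B) where
  Hom F G := NNatTrans F G
  id F := ⟨𝟙 F.toFunctor, fun _ => B.one_le_nrm_id _⟩
  comp α β := ⟨α.toNatTrans ≫ β.toNatTrans, fun a => by
    have h := mul_le_mul' (β.one_le_nrm a) (α.one_le_nrm a)
    rw [one_mul] at h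
    exact h.trans (B.nrm_mul_nrm_le _ _)⟩
  id_comp _ := NNatTrans.ext (Category.id_comp _)
  comp_id _ := NNatTrans.ext (Category.comp_id _)
  assoc _ _ _ := NNatTrans.ext (Category.assoc _ _ _)

namespace NCat

/-- The opposite `V`-normed category. -/
abbrev op (A : NCat.{w, u} V) : NCat.{w, u} V where
  carrier := A.carrierᵒᵖ
  nrm f := A.nrm f.unop
  one_le_nrm_id a := A.one_le_nrm_id a.unop
  nrm_mul_nrm_le f g := by
    rw [mul_comm]
    exact A.nrm_mul_nrm_le g.unop f.unop

/-- The tensor product of `V`-normed categories, `|(f, g)| = |f| ⊗ |g|`. -/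
abbrev tensor (A B : NCat.{w, u} V) : NCat.{w, u} V where
  carrier := A.carrier × B.carrier
  cat := CategoryTheory.uniformProd A.carrier B.carrier
  nrm {p q} (f : p ⟶ q) := A.nrm f.1 * B.nrm f.2
  one_le_nrm_id a := one_le_mul (A.one_le_nrm_id _) (B.one_le_nrm_id _)
  nrm_mul_nrm_le {p q r} (f : p ⟶ q) (g : q ⟶ r) := by
    rw [mul_mul_mul_comm]
    exact mul_le_mul' (A.nrm_mul_nrm_le _ _) (B.nrm_mul_nrm_le _ _)

/-- The category of `V`-normed sets and arbitrary maps. -/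
instance : Category.{u} (NSet.{u} V) where
  Hom A B := A.carrier → B.carrier
  id A := fun a => a
  comp f g := fun a => g (f a)

variable (V) in
/-- The `V`-normed category of `V`-normed sets and arbitrary maps, `|f| = ⋀ a, [|a|, |f a|]`. -/
abbrev nSet : NCat.{max v (u + 1), u} V where
  carrier := NSet.{u} V
  nrm {A B} (f : A.carrier → B.carrier) := ⨅ a : A.carrier, A.nrm a ⇨ₗ B.nrm (f a)
  one_le_nrm_id A := le_iInf fun a => (VCat.base V).one_le_hom (A.nrm a)
  nrm_mul_nrm_le {A B C} (f : A.carrier → B.carrier) (g : B.carrier → C.carrier) := le_iInf fun a =>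
    le_trans (mul_le_mul' (iInf_le _ (f a)) (iInf_le _ a))
      ((VCat.base V).hom_mul_hom_le (A.nrm a) (B.nrm (f a)) (C.nrm (g (f a))))

end NCat

/-! ### `V`-normed distributors -/

/-- A `V`-normed distributor from `A` to `B` is a `V`-normed functor from `Aᵒᵖ ⊗ B` to the
`V`-normed category of `V`-normed sets. -/
abbrev NDist (A B : NCat.{u, u} V) := NFunctor (A.op.tensor B) (NCat.nSet.{u} V)

namespace NDist

variable {A B C D : NCat.{u, u} V}

/-- The `V`-normed set `Φ(a, b)`. -/
abbrev val (Φ : NDist A B) (a : A.carrier) (b : B.carrier) : NSet.{u} V := Φ.obj (Opposite.op a, b)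

/-- The map `Φ(f, g) : Φ(a, b) → Φ(a', b')`. -/
def act (Φ : NDist A B) {a a' : A.carrier} {b b' : B.carrier} (f : a' ⟶ a) (g : b ⟶ b') :
    (Φ.val a b).carrier → (Φ.val a' b').carrier :=
  Φ.map (X := (Opposite.op a, b)) (Y := (Opposite.op a', b')) (f.op, g)

@[simp]
theorem act_id (Φ : NDist A B) {a : A.carrier} {b : B.carrier} (u : (Φ.val a b).carrier) :
    Φ.act (𝟙 a) (𝟙 b) u = u :=
  congrFun (Φ.map_id (Opposite.op a, b)) u

theorem act_act (Φ : NDist A B) {a a' a'' : A.carrier} {b b' b'' : B.carrier} (f : a' ⟶ a)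
    (g : b ⟶ b') (f' : a'' ⟶ a') (g' : b' ⟶ b'') (u : (Φ.val a b).carrier) :
    Φ.act f' g' (Φ.act f g u) = Φ.act (f' ≫ f) (g ≫ g') u :=
  (congrFun (Φ.map_comp (X := (Opposite.op a, b)) (Y := (Opposite.op a', b'))
    (Z := (Opposite.op a'', b'')) (f.op, g) (f'.op, g')) u).symm

theorem nrm_act (Φ : NDist A B) {a a' : A.carrier} {b b' : B.carrier} (f : a' ⟶ a)
    (g : b ⟶ b') (u : (Φ.val a b).carrier) :
    A.nrm f * B.nrm g * (Φ.val a b).nrm u ≤ (Φ.val a' b').nrm (Φ.act f g u) :=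
  leftMulResiduation_le_iff_mul_le.1
    ((Φ.nrm_le (a := (Opposite.op a, b)) (a' := (Opposite.op a', b')) (f.op, g)).trans
      (iInf_le _ u))

theorem nrm_act_left (Φ : NDist A B) {a a' : A.carrier} {b : B.carrier} (f : a' ⟶ a)
    (u : (Φ.val a b).carrier) :
    A.nrm f * (Φ.val a b).nrm u ≤ (Φ.val a' b).nrm (Φ.act f (𝟙 b) u) :=
  (mul_le_mul_left (le_mul_of_one_le_right' (B.one_le_nrm_id b)) _).trans (Φ.nrm_act f (𝟙 b) u)

theorem nrm_act_right (Φ : NDist A B) {a : A.carrier} {b b' : B.carrier}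
    (g : b ⟶ b') (u : (Φ.val a b).carrier) :
    B.nrm g * (Φ.val a b).nrm u ≤ (Φ.val a b').nrm (Φ.act (𝟙 a) g u) :=
  (mul_le_mul_left (le_mul_of_one_le_left' (A.one_le_nrm_id a)) _).trans (Φ.nrm_act (𝟙 a) g u)

/-- Build a `V`-normed distributor from its values and its action. -/
abbrev ofVal (val : A.carrier → B.carrier → NSet.{u} V)
    (act : ∀ {a a' : A.carrier} {b b' : B.carrier}, (a' ⟶ a) → (b ⟶ b') →
      (val a b).carrier → (val a' b').carrier)
    (act_id : ∀ a b (u : (val a b).carrier), act (𝟙 a) (𝟙 b) u = u)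
    (act_act : ∀ {a a' a'' : A.carrier} {b b' b'' : B.carrier} (f : a' ⟶ a)
      (g : b ⟶ b') (f' : a'' ⟶ a') (g' : b' ⟶ b'') (u : (val a b).carrier),
      act f' g' (act f g u) = act (f' ≫ f) (g ≫ g') u)
    (nrm_act : ∀ {a a' : A.carrier} {b b' : B.carrier} (f : a' ⟶ a)
      (g : b ⟶ b') (u : (val a b).carrier),
      A.nrm f * B.nrm g * (val a b).nrm u ≤ (val a' b').nrm (act f g u)) : NDist A B where
  obj p := val p.1.unop p.2
  map f := act f.1.unop f.2
  map_id p := funext fun u => act_id p.1.unop p.2 u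
  map_comp f g := funext fun u => (act_act f.1.unop f.2 g.1.unop g.2 u).symm
  nrm_le f := le_iInf fun u => leftMulResiduation_le_iff_mul_le.2 (nrm_act f.1.unop f.2 u)

/-- The component at `(a, b)` of a 2-cell. -/
def app {Φ Ψ : NDist A B} (α : Φ ⟶ Ψ) (a : A.carrier) (b : B.carrier) :
    (Φ.val a b).carrier → (Ψ.val a b).carrier :=
  α.toNatTrans.app (Opposite.op a, b)

theorem app_act {Φ Ψ : NDist A B} (α : Φ ⟶ Ψ) {a a' : A.carrier} {b b' : B.carrier}
    (f : a' ⟶ a) (g : b ⟶ b') (u : (Φ.val a b).carrier) :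
    app α a' b' (Φ.act f g u) = Ψ.act f g (app α a b u) :=
  congrFun (α.toNatTrans.naturality (X := (Opposite.op a, b)) (Y := (Opposite.op a', b'))
    (f.op, g)) u

theorem nrm_app {Φ Ψ : NDist A B} (α : Φ ⟶ Ψ) (a : A.carrier) (b : B.carrier)
    (u : (Φ.val a b).carrier) : (Φ.val a b).nrm u ≤ (Ψ.val a b).nrm (app α a b u) := by
  have h := leftMulResiduation_le_iff_mul_le.1
    ((α.one_le_nrm (Opposite.op a, b)).trans (iInf_le _ u))
  rwa [one_mul] at h

/-- Build a 2-cell from its components. -/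
def ofApp {Φ Ψ : NDist A B} (app : ∀ a b, (Φ.val a b).carrier → (Ψ.val a b).carrier)
    (app_act : ∀ {a a' : A.carrier} {b b' : B.carrier} (f : a' ⟶ a) (g : b ⟶ b')
      (u : (Φ.val a b).carrier), app a' b' (Φ.act f g u) = Ψ.act f g (app a b u))
    (nrm_app : ∀ a b u, (Φ.val a b).nrm u ≤ (Ψ.val a b).nrm (app a b u)) : Φ ⟶ Ψ where
  toNatTrans :=
    { app := fun p => app p.1.unop p.2
      naturality := fun _ _ f => funext fun u => app_act f.1.unop f.2 u }
  one_le_nrm p := le_iInf fun u => leftMulResiduation_le_iff_mul_le.2 (by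
    rw [one_mul]
    exact nrm_app p.1.unop p.2 u)

theorem hom_ext {Φ Ψ : NDist A B} {α β : Φ ⟶ Ψ} (h : ∀ a b u, app α a b u = app β a b u) :
    α = β :=
  NNatTrans.ext (NatTrans.ext (funext fun p => funext fun u => h p.1.unop p.2 u))

/-- The identity distributor `A(-, -)`. -/
abbrev id (A : NCat.{u, u} V) : NDist A A :=
  ofVal (fun a b => ⟨a ⟶ b, A.nrm⟩) (fun f g h => f ≫ h ≫ g)
    (fun _ _ h => by simp) (fun _ _ _ _ h => by simp)
    (fun f g h => by
      change A.nrm f * A.nrm g * A.nrm h ≤ A.nrm (f ≫ h ≫ g)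
      refine le_trans ?_ (A.nrm_mul_nrm_le _ _)
      rw [mul_comm (A.nrm f), mul_assoc, mul_comm (A.nrm f), ← mul_assoc]
      exact mul_le_mul_left (A.nrm_mul_nrm_le _ _) _)

/-- The relation on `∑ b, Ψ(b, c) × Φ(a, b)` generating the equivalence relation that defines the
coend: `(v, Φ(1, h) u) ∼ (Ψ(h, 1) v, u)`. -/
inductive CoendRel (Φ : NDist A B) (Ψ : NDist B C) (a : A.carrier) (c : C.carrier) :
    (Σ b, (Ψ.val b c).carrier × (Φ.val a b).carrier) →
      (Σ b, (Ψ.val b c).carrier × (Φ.val a b).carrier) → Prop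
  | mk {b b' : B.carrier} (h : b ⟶ b') (v : (Ψ.val b' c).carrier) (u : (Φ.val a b).carrier) :
      CoendRel Φ Ψ a c ⟨b', v, Φ.act (𝟙 a) h u⟩ ⟨b, Ψ.act h (𝟙 c) v, u⟩

/-- The coend of `Ψ(b, c) ⊗ Φ(a, b)` over `b`, in the category of `V`-normed sets: the coend of
sets, with the final norm. -/
abbrev coend (Φ : NDist A B) (Ψ : NDist B C) (a : A.carrier) (c : C.carrier) : NSet.{u} V where
  carrier := Quot (CoendRel Φ Ψ a c)
  nrm z := ⨆ p : {p : Σ b, (Ψ.val b c).carrier × (Φ.val a b).carrier //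
    Quot.mk (CoendRel Φ Ψ a c) p = z}, (Ψ.val p.1.1 c).nrm p.1.2.1 * (Φ.val a p.1.1).nrm p.1.2.2

/-- The class `[(v, u)]`. -/
def cmk (Φ : NDist A B) (Ψ : NDist B C) {a : A.carrier} {c : C.carrier} (b : B.carrier)
    (v : (Ψ.val b c).carrier) (u : (Φ.val a b).carrier) : (coend Φ Ψ a c).carrier :=
  Quot.mk _ ⟨b, v, u⟩

theorem cmk_act (Φ : NDist A B) (Ψ : NDist B C) {a : A.carrier} {c : C.carrier} {b b' : B.carrier}
    (h : b ⟶ b') (v : (Ψ.val b' c).carrier) (u : (Φ.val a b).carrier) :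
    cmk Φ Ψ b' v (Φ.act (𝟙 a) h u) = cmk Φ Ψ b (Ψ.act h (𝟙 c) v) u :=
  Quot.sound (CoendRel.mk h v u)

theorem cind {Φ : NDist A B} {Ψ : NDist B C} {a : A.carrier} {c : C.carrier}
    {P : (coend Φ Ψ a c).carrier → Prop} (h : ∀ b v u, P (cmk Φ Ψ b v u)) (z) : P z :=
  Quot.ind (fun p => h p.1 p.2.1 p.2.2) z

theorem le_nrm_cmk (Φ : NDist A B) (Ψ : NDist B C) {a : A.carrier} {c : C.carrier} (b : B.carrier)
    (v : (Ψ.val b c).carrier) (u : (Φ.val a b).carrier) :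
    (Ψ.val b c).nrm v * (Φ.val a b).nrm u ≤ (coend Φ Ψ a c).nrm (cmk Φ Ψ b v u) :=
  le_iSup (fun p : {p : Σ b, (Ψ.val b c).carrier × (Φ.val a b).carrier //
    Quot.mk (CoendRel Φ Ψ a c) p = cmk Φ Ψ b v u} =>
      (Ψ.val p.1.1 c).nrm p.1.2.1 * (Φ.val a p.1.1).nrm p.1.2.2) ⟨⟨b, v, u⟩, rfl⟩

theorem nrm_coend_le {Φ : NDist A B} {Ψ : NDist B C} {a : A.carrier} {c : C.carrier}
    {P : (coend Φ Ψ a c).carrier → V}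
    (h : ∀ b v u, (Ψ.val b c).nrm v * (Φ.val a b).nrm u ≤ P (cmk Φ Ψ b v u)) (z) :
    (coend Φ Ψ a c).nrm z ≤ P z :=
  iSup_le fun ⟨p, hp⟩ => hp ▸ h p.1 p.2.1 p.2.2

theorem mul_nrm_coend_le {Φ : NDist A B} {Ψ : NDist B C} {a : A.carrier} {c : C.carrier} (x : V)
    {P : (coend Φ Ψ a c).carrier → V}
    (h : ∀ b v u, x * ((Ψ.val b c).nrm v * (Φ.val a b).nrm u) ≤ P (cmk Φ Ψ b v u)) (z) :
    x * (coend Φ Ψ a c).nrm z ≤ P z := by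
  rw [mul_comm, ← leftMulResiduation_le_iff_mul_le]
  refine nrm_coend_le (P := fun z => x ⇨ₗ P z) (fun b v u => ?_) z
  rw [leftMulResiduation_le_iff_mul_le, mul_comm]
  exact h b v u

/-- Maps out of a coend. -/
def cdesc {Φ : NDist A B} {Ψ : NDist B C} {a : A.carrier} {c : C.carrier} {K : Type w}
    (f : ∀ b, (Ψ.val b c).carrier → (Φ.val a b).carrier → K)
    (hf : ∀ {b b' : B.carrier} (h : b ⟶ b') v u, f b' v (Φ.act (𝟙 a) h u)
      = f b (Ψ.act h (𝟙 c) v) u) : (coend Φ Ψ a c).carrier → K :=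
  Quot.lift (fun p => f p.1 p.2.1 p.2.2) (by
    rintro _ _ ⟨h, v, u⟩
    exact hf h v u)

/-- The composite `Ψ · Φ` of `V`-normed distributors. -/
abbrev comp (Φ : NDist A B) (Ψ : NDist B C) : NDist A C :=
  ofVal (coend Φ Ψ)
    (fun f g => cdesc (fun b v u => cmk Φ Ψ b (Ψ.act (𝟙 b) g v) (Φ.act f (𝟙 b) u))
      (fun {b b'} h v u => by
        have h1 : Φ.act f (𝟙 b') (Φ.act (𝟙 _) h u) = Φ.act (𝟙 _) h (Φ.act f (𝟙 b) u) := by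
          simp only [act_act, Category.id_comp, Category.comp_id]
        rw [h1, cmk_act]
        simp only [act_act, Category.id_comp, Category.comp_id]))
    (fun a c => cind fun b v u => by
      change cmk Φ Ψ b (Ψ.act (𝟙 b) (𝟙 c) v) (Φ.act (𝟙 a) (𝟙 b) u) = _
      simp only [act_id])
    (fun f g f' g' => cind fun b v u => by
      change cmk Φ Ψ b (Ψ.act (𝟙 b) g' (Ψ.act (𝟙 b) g v)) (Φ.act f' (𝟙 b) (Φ.act f (𝟙 b) u))
        = cmk Φ Ψ b (Ψ.act (𝟙 b) (g ≫ g') v) (Φ.act (f' ≫ f) (𝟙 b) u)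
      simp only [act_act, Category.id_comp])
    (fun f g => mul_nrm_coend_le _ fun b v u => by
      refine le_trans ?_ (le_nrm_cmk Φ Ψ b (Ψ.act (𝟙 b) g v) (Φ.act f (𝟙 b) u))
      rw [mul_comm (A.nrm f), mul_mul_mul_comm]
      exact mul_le_mul' (Ψ.nrm_act_right g v) (Φ.nrm_act_left f u))

theorem comp_act (Φ : NDist A B) (Ψ : NDist B C) {a a' : A.carrier} {c c' : C.carrier}
    (f : a' ⟶ a) (g : c ⟶ c') (b : B.carrier) (v : (Ψ.val b c).carrier)
    (u : (Φ.val a b).carrier) :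
    (comp Φ Ψ).act f g (cmk Φ Ψ b v u) = cmk Φ Ψ b (Ψ.act (𝟙 b) g v) (Φ.act f (𝟙 b) u) := rfl

/-- Horizontal composition of 2-cells, `[(v, u)] ↦ [(β v, α u)]`. -/
def hcomp {Φ Φ' : NDist A B} {Ψ Ψ' : NDist B C} (α : Φ ⟶ Φ') (β : Ψ ⟶ Ψ') :
    comp Φ Ψ ⟶ comp Φ' Ψ' :=
  ofApp (fun a c => cdesc (fun b v u => cmk Φ' Ψ' b (app β b c v) (app α a b u))
      (fun h v u => by rw [app_act, app_act, cmk_act]))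
    (fun {a a' c c'} f g => cind fun b v u => by
      change cmk Φ' Ψ' b (app β b c' (Ψ.act (𝟙 b) g v)) (app α a' b (Φ.act f (𝟙 b) u))
        = cmk Φ' Ψ' b (Ψ'.act (𝟙 b) g (app β b c v)) (Φ'.act f (𝟙 b) (app α a b u))
      rw [app_act, app_act])
    (fun a c => nrm_coend_le fun b v u =>
      (mul_le_mul' (nrm_app β b c v) (nrm_app α a b u)).trans (le_nrm_cmk Φ' Ψ' b _ _))

/-- The associator, `[(w, [(v, u)])] ↦ [([(w, v)], u)]`. -/
def assocHom (Φ : NDist A B) (Ψ : NDist B C) (Ω : NDist C D) :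
    comp (comp Φ Ψ) Ω ⟶ comp Φ (comp Ψ Ω) :=
  ofApp (fun a d => cdesc
      (fun c w => cdesc (fun b v u => cmk Φ (comp Ψ Ω) b (cmk Ψ Ω c w v) u)
        (fun h v u => cmk_act Φ (comp Ψ Ω) h (cmk Ψ Ω c w v) u |>.trans (by
          rw [comp_act, act_id])))
      (fun {c c'} h w => cind fun b v u => by
        change cmk Φ (comp Ψ Ω) b (cmk Ψ Ω c' w (Ψ.act (𝟙 b) h v)) (Φ.act (𝟙 a) (𝟙 b) u)
          = cmk Φ (comp Ψ Ω) b (cmk Ψ Ω c (Ω.act h (𝟙 d) w) v) u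
        rw [act_id, cmk_act]))
    (fun {a a' d d'} f g => cind fun c w => cind fun b v u => by
      change cmk Φ (comp Ψ Ω) b (cmk Ψ Ω c (Ω.act (𝟙 c) g w) (Ψ.act (𝟙 b) (𝟙 c) v))
          (Φ.act f (𝟙 b) u)
        = cmk Φ (comp Ψ Ω) b (cmk Ψ Ω c (Ω.act (𝟙 c) g w) (Ψ.act (𝟙 b) (𝟙 c) v))
          (Φ.act f (𝟙 b) u)
      rfl)
    (fun a d => nrm_coend_le fun c w => mul_nrm_coend_le _ fun b v u => by
      rw [← mul_assoc]
      exact (mul_le_mul_left (le_nrm_cmk Ψ Ω c w v) _).trans (le_nrm_cmk Φ (comp Ψ Ω) b _ u))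

/-- The inverse associator, `[([(w, v)], u)] ↦ [(w, [(v, u)])]`. -/
def assocInv (Φ : NDist A B) (Ψ : NDist B C) (Ω : NDist C D) :
    comp Φ (comp Ψ Ω) ⟶ comp (comp Φ Ψ) Ω :=
  ofApp (fun a d => cdesc
      (fun b z u => cdesc (fun c w v => cmk (comp Φ Ψ) Ω c w (cmk Φ Ψ b v u))
        (fun {c c'} h w v => by
          rw [← cmk_act (comp Φ Ψ) Ω h w (cmk Φ Ψ b v u), comp_act, act_id]) z)
      (fun {b b'} h z u => by
        revert z
        refine cind fun c w v => ?_
        change cmk (comp Φ Ψ) Ω c w (cmk Φ Ψ b' v (Φ.act (𝟙 a) h u))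
          = cmk (comp Φ Ψ) Ω c (Ω.act (𝟙 c) (𝟙 d) w) (cmk Φ Ψ b (Ψ.act h (𝟙 c) v) u)
        rw [act_id, cmk_act]))
    (fun {a a' d d'} f g => cind fun b z u => by
      revert z
      refine cind fun c w v => ?_
      rfl)
    (fun a d => nrm_coend_le fun b z u => by
      rw [mul_comm]
      revert z
      refine mul_nrm_coend_le _ fun c w v => ?_
      rw [mul_comm, mul_assoc]
      exact (mul_le_mul_right (le_nrm_cmk Φ Ψ b v u) _).trans (le_nrm_cmk (comp Φ Ψ) Ω c w _))

/-- The left unitor, `[(v, f)] ↦ Φ(f, 1) v`. -/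
def leftHom (Φ : NDist A B) : comp (id A) Φ ⟶ Φ :=
  ofApp (fun a b => cdesc (fun a' v f => Φ.act f (𝟙 b) v)
      (fun {a' a''} h v f => by
        change Φ.act (𝟙 a ≫ f ≫ h) (𝟙 b) v = Φ.act f (𝟙 b) (Φ.act h (𝟙 b) v)
        simp only [act_act, Category.id_comp]))
    (fun {a a' b b'} f g => cind fun a'' v h => by
      change Φ.act (f ≫ h ≫ 𝟙 a'') (𝟙 b') (Φ.act (𝟙 a'') g v) = Φ.act f g (Φ.act h (𝟙 b) v)
      simp only [act_act, Category.id_comp, Category.comp_id])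
    (fun a b => nrm_coend_le fun a' v f => by
      rw [mul_comm]
      exact Φ.nrm_act_left f v)

/-- The inverse left unitor, `u ↦ [(u, 1)]`. -/
def leftInv (Φ : NDist A B) : Φ ⟶ comp (id A) Φ :=
  ofApp (fun a b u => cmk (id A) Φ a u (𝟙 a))
    (fun {a a' b b'} f g u => by
      change cmk (id A) Φ a' (Φ.act f g u) (𝟙 a')
        = cmk (id A) Φ a (Φ.act (𝟙 a) g u) (f ≫ 𝟙 a ≫ 𝟙 a)
      have h := cmk_act (id A) Φ f (Φ.act (𝟙 a) g u) (𝟙 a')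
      rw [act_act, Category.comp_id, Category.comp_id] at h
      rw [← h]
      change cmk (id A) Φ a _ (𝟙 a' ≫ 𝟙 a' ≫ f) = _
      simp only [Category.id_comp, Category.comp_id])
    (fun a b u => le_trans (le_mul_of_one_le_right' (A.one_le_nrm_id a))
      (le_nrm_cmk (id A) Φ a u (𝟙 a)))

/-- The right unitor, `[(f, u)] ↦ Φ(1, f) u`. -/
def rightHom (Φ : NDist A B) : comp Φ (id B) ⟶ Φ :=
  ofApp (fun a b => cdesc (fun b' f u => Φ.act (𝟙 a) f u)
      (fun {b' b''} h f u => by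
        change Φ.act (𝟙 a) f (Φ.act (𝟙 a) h u) = Φ.act (𝟙 a) (h ≫ f ≫ 𝟙 b) u
        simp only [act_act, Category.comp_id]))
    (fun {a a' b b'} f g => cind fun b'' h u => by
      change Φ.act (𝟙 a') (𝟙 b'' ≫ h ≫ g) (Φ.act f (𝟙 b'') u) = Φ.act f g (Φ.act (𝟙 a) h u)
      simp only [act_act, Category.id_comp, Category.comp_id])
    (fun a b => nrm_coend_le fun b' f u => Φ.nrm_act_right f u)

/-- The inverse right unitor, `u ↦ [(1, u)]`. -/
def rightInv (Φ : NDist A B) : Φ ⟶ comp Φ (id B) :=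
  ofApp (fun a b u => cmk Φ (id B) b (𝟙 b) u)
    (fun {a a' b b'} f g u => by
      change cmk Φ (id B) b' (𝟙 b') (Φ.act f g u)
        = cmk Φ (id B) b (𝟙 b ≫ 𝟙 b ≫ g) (Φ.act f (𝟙 b) u)
      have h := cmk_act Φ (id B) g (𝟙 b') (Φ.act f (𝟙 b) u)
      rw [act_act, Category.id_comp, Category.id_comp] at h
      rw [h]
      change cmk Φ (id B) b (g ≫ 𝟙 b' ≫ 𝟙 b') _ = _
      simp only [Category.id_comp, Category.comp_id])
    (fun a b u => le_trans (le_mul_of_one_le_left' (B.one_le_nrm_id b))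
      (le_nrm_cmk Φ (id B) b (𝟙 b) u))

theorem leftInv_act (Φ : NDist A B) {a a' : A.carrier} {b : B.carrier} (f : a ⟶ a')
    (v : (Φ.val a' b).carrier) :
    app (leftInv Φ) a b (Φ.act f (𝟙 b) v) = cmk (id A) Φ a' v f := by
  change cmk (id A) Φ a (Φ.act f (𝟙 b) v) (𝟙 a) = _
  rw [← cmk_act (id A) Φ f v (𝟙 a)]
  change cmk (id A) Φ a' v (𝟙 a ≫ 𝟙 a ≫ f) = _
  simp only [Category.id_comp]

theorem rightInv_act (Φ : NDist A B) {a : A.carrier} {b b' : B.carrier} (f : b' ⟶ b)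
    (u : (Φ.val a b').carrier) :
    app (rightInv Φ) a b (Φ.act (𝟙 a) f u) = cmk Φ (id B) b' f u := by
  change cmk Φ (id B) b (𝟙 b) (Φ.act (𝟙 a) f u) = _
  rw [cmk_act Φ (id B) f (𝟙 b) u]
  change cmk Φ (id B) b' (f ≫ 𝟙 b ≫ 𝟙 b) u = _
  simp only [Category.comp_id]

end NDist

/-- The bicategory of small `V`-normed categories, `V`-normed distributors and `V`-normed natural
transformations. -/
instance : Bicategory (NCat.{u, u} V) where
  Hom A B := NDist A B
  id A := NDist.id A
  comp Φ Ψ := NDist.comp Φ Ψ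
  homCategory A B := inferInstanceAs (Category (NFunctor _ _))
  whiskerLeft Φ _ _ η := NDist.hcomp (𝟙 Φ) η
  whiskerRight η Ψ := NDist.hcomp η (𝟙 Ψ)
  associator Φ Ψ Ω := ⟨NDist.assocHom Φ Ψ Ω, NDist.assocInv Φ Ψ Ω,
    NDist.hom_ext fun _ _ => NDist.cind fun _ _ => NDist.cind fun _ _ _ => rfl,
    NDist.hom_ext fun _ _ => NDist.cind fun _ z u => by
      revert z
      exact NDist.cind fun _ _ _ => rfl⟩
  leftUnitor Φ := ⟨NDist.leftHom Φ, NDist.leftInv Φ,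
    NDist.hom_ext fun _ _ => NDist.cind fun _ v f => NDist.leftInv_act Φ f v,
    NDist.hom_ext fun _ _ u => Φ.act_id u⟩
  rightUnitor Φ := ⟨NDist.rightHom Φ, NDist.rightInv Φ,
    NDist.hom_ext fun _ _ => NDist.cind fun _ f u => NDist.rightInv_act Φ f u,
    NDist.hom_ext fun _ _ u => Φ.act_id u⟩
  whiskerLeft_id _ _ := NDist.hom_ext fun _ _ => NDist.cind fun _ _ _ => rfl
  whiskerLeft_comp _ _ _ _ _ _ := NDist.hom_ext fun _ _ => NDist.cind fun _ _ _ => rfl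
  id_whiskerLeft {_ _ _ Ψ} η := NDist.hom_ext fun _ _ => NDist.cind fun _ v f =>
    ((congrArg (NDist.app (NDist.leftInv Ψ) _ _) (NDist.app_act η f (𝟙 _) v)).trans
      (NDist.leftInv_act Ψ f _)).symm
  comp_whiskerLeft _ _ _ _ _ := NDist.hom_ext fun _ _ => NDist.cind fun _ v z => by
    revert z
    exact NDist.cind fun _ _ _ => rfl
  id_whiskerRight _ _ := NDist.hom_ext fun _ _ => NDist.cind fun _ _ _ => rfl
  comp_whiskerRight _ _ _ := NDist.hom_ext fun _ _ => NDist.cind fun _ _ _ => rfl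
  whiskerRight_id {_ _ _ Ψ} η := NDist.hom_ext fun _ _ => NDist.cind fun _ f u =>
    ((congrArg (NDist.app (NDist.rightInv Ψ) _ _) (NDist.app_act η (𝟙 _) f u)).trans
      (NDist.rightInv_act Ψ f _)).symm
  whiskerRight_comp _ _ _ := NDist.hom_ext fun _ _ => NDist.cind fun _ z u => by
    revert z
    exact NDist.cind fun _ _ _ => rfl
  whisker_assoc _ _ _ _ _ := NDist.hom_ext fun _ _ => NDist.cind fun _ v z => by
    revert z
    exact NDist.cind fun _ _ _ => rfl
  whisker_exchange _ _ := NDist.hom_ext fun _ _ => NDist.cind fun _ _ _ => rfl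
  pentagon _ _ _ _ := NDist.hom_ext fun _ _ => NDist.cind fun _ x z => by
    revert z
    refine NDist.cind fun _ w z => ?_
    revert z
    exact NDist.cind fun _ _ _ => rfl
  triangle Φ Ψ := NDist.hom_ext fun _ _ => NDist.cind fun _ v z => by
    revert z
    exact NDist.cind fun _ f u => (NDist.cmk_act Φ Ψ f v u).symm

/-- The distributor `F_*` of a `V`-normed functor `F : A → B`, `F_*(a, b) = B(F a, b)`. -/
def NFunctor.lowerStar {A B : NCat.{u, u} V} (F : NFunctor A B) : NDist A B :=
  NDist.ofVal (fun a b => ⟨F.obj a ⟶ b, B.nrm⟩) (fun f g h => F.map f ≫ h ≫ g)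
    (fun _ _ h => by simp) (fun _ _ _ _ h => by simp)
    (fun f g h => by
      refine le_trans ?_ ((NDist.id B).nrm_act (F.map f) g h)
      exact mul_le_mul_left (mul_le_mul_left (F.nrm_le _) _) _)

/-- A small `V`-normed category is Lawvere complete when every `V`-normed distributor into it that
is a left adjoint in the bicategory of `V`-normed distributors is representable. -/
def NCat.LawvereComplete (A : NCat.{u, u} V) : Prop :=
  ∀ (X : NCat.{u, u} V) (Φ : X ⟶ A), IsLeftAdjoint Φ →
    ∃ F : NFunctor X A, Nonempty (Φ ≅ (F.lowerStar : X ⟶ A))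

/-- The `V`-normed category `i(X)` of a `V`-category `X`: the same objects, exactly one arrow
`x → y` for all `x` and `y`, and this arrow has norm `X(x, y)`. -/
def VCat.toNCat (X : VCat.{u} V) : NCat.{u, u} V where
  carrier := X.carrier
  cat :=
    { Hom := fun _ _ => PUnit
      id := fun _ => PUnit.unit
      comp := fun _ _ => PUnit.unit }
  nrm {x y} _ := X.hom x y
  one_le_nrm_id x := X.one_le_hom x
  nrm_mul_nrm_le {x y z} _ _ := X.hom_mul_hom_le x y z

end Quantale

/-!
The assignment `X ↦ i(X)` has a reflector: collapsing every hom-set `A(a, b)` of a normed category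
to the single value `⋁ f, |f|` turns normed categories into `V`-categories and normed distributors
into `V`-distributors (`NCat.toVCat`, `NDist.toVDist`). A unit and a counit survive the collapse,
and triangle identities between `V`-distributors are automatic, so left adjoints are preserved
(`NDist.isLeftAdjoint_toVDist`). Moreover `i(X)` collapses to `X` (`VCat.toVCat_toNCat`).

If `X` is Lawvere complete and `Φ : A ⇸ i(X)` is a left adjoint, the collapse of `Φ` is therefore
`F_*` for some `V`-functor `F`, which is the same thing as a normed functor `A → i(X)`. To recover
`Φ` itself from its collapse one needs all sets `Φ(a, x)` to be singletons. The underlying category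
of `i(X)` is indiscrete; if the unit sends `1_a` to the class of `(v₀, u₀)` with `u₀ ∈ Φ(a, x₀)`,
the left triangle identity reads `u = Φ(1, ε[(u, v₀)]) u₀` for every `u ∈ Φ(a, x)`, so `u` is the
translate of `u₀` along the only arrow `x₀ → x` (`NDist.nonempty_unique_val`).

Conversely a `V`-distributor `φ` becomes a normed distributor with singleton values normed by `φ`
(`VDist.toNDist`). A coend of two of these over a non-empty `i(X)` is again a singleton, normed by
the value of the composite `V`-distributor. So an adjunction `φ ⊣ ψ` with `φ : Y ⇸ X` lifts to
singleton-valued normed distributors as soon as `X` is non-empty or `Y` is empty. The remaining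
case, `X` empty and `Y` not, forces `k ≤ Y(y, y) ≤ ⊥`, so that `V` is trivial.
-/

section Comparison

variable {V : Type v} [CommMonoid V] [CompleteLattice V] [IsQuantale V]

theorem VDist.val_le_of_hom {X Y : VCat.{u} V} {φ ψ : X ⟶ Y} (α : φ ⟶ ψ) (x : X.carrier)
    (y : Y.carrier) : VDist.val φ x y ≤ VDist.val ψ x y :=
  VDist.le_iff.1 (leOfHom α) x y

/-- The 2-cell given by a pointwise inequality of `V`-distributors. -/
def VDist.homOfVal {X Y : VCat.{u} V} {φ ψ : X ⟶ Y}
    (h : ∀ x y, VDist.val φ x y ≤ VDist.val ψ x y) : φ ⟶ ψ :=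
  homOfLE (X := VDist X Y) (VDist.le_iff.2 h)

/-- The left triangle identity of an adjunction, with the associator explicit. -/
theorem whisker_left_triangle {𝓑 : Type*} [Bicategory 𝓑] {a b : 𝓑} {f : a ⟶ b} {g : b ⟶ a}
    (adj : f ⊣ g) :
    adj.unit ▷ f ≫ (α_ f g f).hom ≫ f ◁ adj.counit = (λ_ f).hom ≫ (ρ_ f).inv := by
  rw [← adj.left_triangle, leftZigzag]
  bicategory

/-! ### Collapsing normed hom-sets to their suprema -/

/-- The `V`-category with the objects of `A` and `A(a, b) = ⋁ f, |f|`. -/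
def NCat.toVCat (A : NCat.{u, u} V) : VCat.{u} V where
  carrier := A.carrier
  hom a b := ⨆ f : a ⟶ b, A.nrm f
  one_le_hom a := le_iSup_of_le (𝟙 a) (A.one_le_nrm_id a)
  hom_mul_hom_le a b c := by
    rw [iSup_mul_distrib]
    refine iSup_le fun g => ?_
    rw [mul_iSup_distrib]
    exact iSup_le fun f => le_iSup_of_le (f ≫ g) (A.nrm_mul_nrm_le f g)

theorem VCat.toVCat_toNCat (X : VCat.{u} V) : X.toNCat.toVCat = X := by
  obtain ⟨C, h, h₁, h₂⟩ := X
  have : (fun x y : C => ⨆ _ : PUnit.{u + 1}, h x y) = h := by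
    funext x y
    exact iSup_const
  simp only [NCat.toVCat, VCat.toNCat, VCat.mk.injEq, heq_eq_eq, true_and]
  exact this

namespace NDist

variable {A B : NCat.{u, u} V}

/-- The `V`-distributor with values `⋁ u ∈ Φ(a, b), |u|`. -/
def toVDist (Φ : NDist A B) : VDist A.toVCat B.toVCat :=
  VDist.ofVal (fun a b => ⨆ u : (Φ.val a b).carrier, (Φ.val a b).nrm u)
      fun (a' a : A.carrier) (b b' : B.carrier) => by
    dsimp only [NCat.toVCat]
    rw [iSup_mul_distrib, iSup_mul_distrib]
    refine iSup_le fun f => ?_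
    rw [mul_iSup_distrib]
    refine iSup_le fun u => ?_
    rw [mul_iSup_distrib, iSup_mul_distrib]
    exact iSup_le fun g => le_iSup_of_le (Φ.act f g u) (Φ.nrm_act f g u)

theorem nrm_le_toVDist_val (Φ : NDist A B) {a : A.carrier} {b : B.carrier}
    (u : (Φ.val a b).carrier) : (Φ.val a b).nrm u ≤ Φ.toVDist.val a b :=
  le_iSup (fun u => (Φ.val a b).nrm u) u

/-- Collapsing preserves left adjoints: the unit and counit give pointwise inequalities between
suprema, and the triangle identities hold because `V`-distributors form preorders. -/
theorem isLeftAdjoint_toVDist (Φ : A ⟶ B) (h : IsLeftAdjoint Φ) :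
    IsLeftAdjoint (B := VCat.{u} V) (a := A.toVCat) (b := B.toVCat) (toVDist Φ) := by
  obtain ⟨Ψ, adj⟩ := h
  refine IsLeftAdjoint.mk (g := (toVDist Ψ : B.toVCat ⟶ A.toVCat))
    { unit := VDist.homOfVal fun a a' => iSup_le fun f => ?_
      counit := VDist.homOfVal fun b b' => iSup_le fun a => ?_
      left_triangle := Subsingleton.elim (α := ULift (PLift _)) _ _
      right_triangle := Subsingleton.elim (α := ULift (PLift _)) _ _ }
  · refine (nrm_app adj.unit a a' f).trans ?_
    exact nrm_coend_le (P := fun _ => (VDist.comp (toVDist Φ) (toVDist Ψ)).val a a')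
      (fun b v u => le_iSup_of_le b (mul_le_mul' (nrm_le_toVDist_val Ψ v)
        (nrm_le_toVDist_val Φ u))) _
  · change (⨆ u, (val Φ a b').nrm u) * (⨆ v, (val Ψ b a).nrm v) ≤ _
    rw [iSup_mul_distrib]
    refine iSup_le fun u => ?_
    rw [mul_iSup_distrib]
    exact iSup_le fun v => le_iSup_of_le (app adj.counit b b' (cmk Ψ Φ a u v))
      ((le_nrm_cmk Ψ Φ a u v).trans (nrm_app adj.counit b b' _))

/-! ### Left adjoints into an indiscrete category are singleton-valued -/

/-- If `Φ` is a left adjoint, every `Φ(a, -)` is generated by a single element `u₀`. By the left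
triangle identity, any representative `(v₀, u₀)` of the image of `1_a` under the unit provides one,
the arrow `g` being the image of `[(u, v₀)]` under the counit. -/
theorem exists_act_eq {Φ : A ⟶ B} {Ψ : B ⟶ A} (adj : Φ ⊣ Ψ) (a : A.carrier) :
    ∃ (b₀ : B.carrier) (u₀ : (val Φ a b₀).carrier), ∀ (b : B.carrier) (u : (val Φ a b).carrier),
      ∃ g : b₀ ⟶ b, act Φ (𝟙 a) g u₀ = u := by
  have key : ∀ z : (coend Φ Ψ a a).carrier, app adj.unit a a (𝟙 a) = z →
      ∃ (b₀ : B.carrier) (u₀ : (val Φ a b₀).carrier), ∀ (b : B.carrier)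
        (u : (val Φ a b).carrier), ∃ g : b₀ ⟶ b, act Φ (𝟙 a) g u₀ = u := by
    refine cind fun b₀ v₀ u₀ hz => ⟨b₀, u₀, fun b u => ⟨app adj.counit b₀ b (cmk Ψ Φ a u v₀), ?_⟩⟩
    have h := congrArg (fun τ => app (rightHom Φ) a b (app τ a b (cmk (id A) Φ a u (𝟙 a))))
      (whisker_left_triangle adj)
    change app (rightHom Φ) a b (app (Φ ◁ adj.counit) a b (app (assocHom Φ Ψ Φ) a b
      (cmk (comp Φ Ψ) Φ a u (app adj.unit a a (𝟙 a))))) =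
        act Φ (𝟙 a) (𝟙 b) (act Φ (𝟙 a) (𝟙 b) u) at h
    rw [hz, act_id, act_id] at h
    exact h
  exact key _ rfl

theorem nonempty_unique_val {X : VCat.{u} V} (Φ : A ⟶ X.toNCat) (h : IsLeftAdjoint Φ)
    (a : A.carrier) (x : X.carrier) : Nonempty (Unique (val (B := X.toNCat) Φ a x).carrier) := by
  obtain ⟨Ψ, adj⟩ := h
  obtain ⟨x₀, u₀, hu₀⟩ := exists_act_eq adj a
  refine ⟨⟨⟨act (B := X.toNCat) Φ (𝟙 a) PUnit.unit u₀⟩, fun u => ?_⟩⟩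
  obtain ⟨g, rfl⟩ := hu₀ x u
  rfl

end NDist

/-! ### Singleton-valued normed distributors -/

namespace VDist

variable {X Y Z : VCat.{u} V}

/-- The normed distributor `i(X) ⇸ i(Y)` with values singletons of norm `φ(x, y)`. -/
def toNDist (φ : VDist X Y) : NDist X.toNCat Y.toNCat :=
  NDist.ofVal (fun x y => ⟨PUnit, fun _ => φ.val x y⟩) (fun _ _ _ => PUnit.unit)
    (fun _ _ _ => rfl) (fun _ _ _ _ _ => rfl)
    (fun {x x' y y'} _ _ _ => φ.act_le x' x y y')

/-- Since `i(Y)` has an arrow between any two objects, all pairs are identified in the coend. -/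
theorem subsingleton_coend_toNDist (φ : VDist X Y) (ψ : VDist Y Z) (x : X.carrier)
    (z : Z.carrier) : Subsingleton (NDist.coend φ.toNDist ψ.toNDist x z).carrier :=
  ⟨NDist.cind fun y _ _ => NDist.cind fun y' _ _ =>
    (NDist.cmk_act φ.toNDist ψ.toNDist (b := y') (b' := y) PUnit.unit PUnit.unit PUnit.unit)⟩

theorem comp_val_le_nrm (φ : VDist X Y) (ψ : VDist Y Z) (x : X.carrier) (z : Z.carrier)
    (w : (NDist.coend φ.toNDist ψ.toNDist x z).carrier) :
    (comp φ ψ).val x z ≤ (NDist.coend φ.toNDist ψ.toNDist x z).nrm w :=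
  iSup_le fun y =>
    (NDist.le_nrm_cmk φ.toNDist ψ.toNDist (a := x) (c := z) y PUnit.unit PUnit.unit).trans_eq
      (congrArg _ ((subsingleton_coend_toNDist φ ψ x z).elim _ _))

/-- The hypothesis `hY` makes the coends over `i(Y)` inhabited, which the unit needs; the triangle
identities hold because they compare maps into coends with at most one element. -/
theorem isLeftAdjoint_toNDist (φ : X ⟶ Y) (h : IsLeftAdjoint φ)
    (hY : X.carrier → Nonempty Y.carrier) :
    IsLeftAdjoint (B := NCat.{u, u} V) (a := X.toNCat) (b := Y.toNCat) (toNDist φ) := by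
  obtain ⟨ψ, adj⟩ := h
  refine IsLeftAdjoint.mk (g := (toNDist ψ : Y.toNCat ⟶ X.toNCat))
    { unit := NDist.ofApp (fun x x' _ => NDist.cmk (toNDist φ) (toNDist ψ)
        (hY x).some PUnit.unit PUnit.unit) (fun _ _ _ => ?_) (fun x x' _ => ?_)
      counit := NDist.ofApp (fun y y' _ => PUnit.unit) (fun _ _ _ => rfl) (fun y y' => ?_)
      left_triangle := NDist.hom_ext fun x y _ =>
        (subsingleton_coend_toNDist φ (id Y) x y).elim _ _
      right_triangle := NDist.hom_ext fun y x _ =>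
        (subsingleton_coend_toNDist (id Y) ψ y x).elim _ _ }
  · exact (subsingleton_coend_toNDist φ ψ _ _).elim _ _
  · exact (VDist.val_le_of_hom adj.unit x x').trans (comp_val_le_nrm φ ψ x x' _)
  · exact NDist.nrm_coend_le (P := fun _ => Y.hom y y') fun x _ _ =>
      (le_iSup (fun x => val φ x y' * val ψ y x) x).trans (VDist.val_le_of_hom adj.counit y y')

/-- If `Y` is empty, composites through `Y` are `⊥`, so the unit of the adjunction gives
`k ≤ X(x, x) ≤ ⊥`, which fails in a nontrivial quantale. -/
theorem nonempty_of_isLeftAdjoint [Nontrivial V] (φ : X ⟶ Y) (h : IsLeftAdjoint φ)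
    (x : X.carrier) : Nonempty Y.carrier := by
  obtain ⟨ψ, adj⟩ := h
  by_contra hY
  rw [not_nonempty_iff] at hY
  have h1 : (1 : V) ≤ ⊥ := (X.one_le_hom x).trans
    ((VDist.val_le_of_hom adj.unit x x).trans (iSup_of_empty _).le)
  have h2 : ∀ a : V, a = ⊥ := fun a => le_bot_iff.1 (by simpa using mul_le_mul_right h1 a)
  obtain ⟨a, b, hab⟩ := exists_pair_ne V
  exact hab ((h2 a).trans (h2 b).symm)

end VDist

/-! ### Transfer of Lawvere completeness -/

theorem VCat.LawvereComplete.toNCat {X : VCat.{u} V} (hX : X.LawvereComplete) :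
    X.toNCat.LawvereComplete := by
  intro A Φ hΦ
  have hX' : X.toNCat.toVCat.LawvereComplete := X.toVCat_toNCat.symm ▸ hX
  obtain ⟨F, ⟨e⟩⟩ := hX' A.toVCat (NDist.toVDist Φ) (NDist.isLeftAdjoint_toVDist Φ hΦ)
  -- Uniqueness makes the norm of the only element of `Φ(a, x)` equal to the collapsed value.
  have U (a : A.carrier) (x : X.carrier) :=
    Classical.choice (NDist.nonempty_unique_val Φ hΦ a x)
  let G : NFunctor A X.toNCat :=
    { obj := F.obj
      map := fun _ => PUnit.unit
      nrm_le := fun {a a'} f => (le_iSup A.nrm f).trans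
        ((F.hom_le a a').trans (iSup_le fun _ => le_rfl)) }
  have hle (a : A.carrier) (x : X.carrier) (u : (NDist.val (B := X.toNCat) Φ a x).carrier) :
      (NDist.val (B := X.toNCat) Φ a x).nrm u ≤ X.hom (F.obj a) x :=
    (NDist.nrm_le_toVDist_val Φ u).trans
      ((VDist.val_le_of_hom e.hom a x).trans (iSup_le fun _ => le_rfl))
  have hge (a : A.carrier) (x : X.carrier) (u : (NDist.val (B := X.toNCat) Φ a x).carrier) :
      X.hom (F.obj a) x ≤ (NDist.val (B := X.toNCat) Φ a x).nrm u :=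
    (le_iSup (fun _ : PUnit.{u + 1} => X.hom (F.obj a) x) PUnit.unit).trans
      ((VDist.val_le_of_hom e.inv a x).trans
        (iSup_le fun u' => ((U a x).instSubsingleton.elim u' u) ▸ le_rfl))
  refine ⟨G, ⟨NDist.ofApp (fun _ _ _ => PUnit.unit) (fun _ _ _ => rfl) hle,
    NDist.ofApp (fun a x _ => (U a x).default)
      (fun _ _ _ => (U _ _).instSubsingleton.elim _ _) (fun a x _ => hge a x _),
    NDist.hom_ext fun a x _ => (U a x).instSubsingleton.elim _ _,
    NDist.hom_ext fun _ _ _ => rfl⟩⟩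

theorem VCat.lawvereComplete_of_toNCat {X : VCat.{u} V} (h : Nonempty X.carrier ∨ Nontrivial V)
    (hX : X.toNCat.LawvereComplete) : X.LawvereComplete := by
  intro Y φ hφ
  have hne : Y.carrier → Nonempty X.carrier := fun y =>
    h.elim (fun h => h) fun _ => VDist.nonempty_of_isLeftAdjoint φ hφ y
  obtain ⟨F, ⟨e⟩⟩ := hX Y.toNCat (VDist.toNDist φ) (VDist.isLeftAdjoint_toNDist φ hφ hne)
  let G : VFunctor Y X := ⟨F.obj, fun y y' => F.nrm_le (a := y) (a' := y') PUnit.unit⟩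
  exact ⟨G, ⟨VDist.homOfVal fun y x => NDist.nrm_app e.hom y x PUnit.unit,
    VDist.homOfVal fun y x => NDist.nrm_app e.inv y x PUnit.unit,
    Subsingleton.elim (α := ULift (PLift _)) _ _, Subsingleton.elim (α := ULift (PLift _)) _ _⟩⟩

end Comparison

theorem corollary2 (V : Type v) [CommMonoid V] [CompleteLattice V] [IsQuantale V]
    (X : VCat.{u} V) (hX : Nonempty X.carrier ∨ Nontrivial V) :
    X.LawvereComplete ↔ X.toNCat.LawvereComplete :=
  ⟨VCat.LawvereComplete.toNCat, VCat.lawvereComplete_of_toNCat hX⟩
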